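/- Let $\mathrm{ZF}^-$ be the theory in the language $\{\in\}$ consisting of Empty Set, Extensionality, Pairing, Unions, Infinity, the Foundation Scheme, the Separation Scheme, the Replacement Scheme and the Collection Scheme (that is, $\mathrm{ZF}$ without Power Set but with Collection). Let $V$ be a model of $\mathrm{ZF}^-$. Then there is no elementary embedding $j : V \to V$ that is (1) non-trivial, i.e. $j(x) \neq x$ for some $x \in V$, (2) cofinal, i.e. for every $y \in V$ there is $x \in V$ with $V \models y \in j(x)$, and (3) definable from parameters, i.e. for some first-order formula $\varphi$ in the language $\{\in\}$ and some finite tuple of parameters $p$ from $V$, for all $x, y \in V$: $j(x) = y$ if and only if $V \models \varphi(x, y, p)$. -/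

import Mathlib

open scoped FirstOrder

namespace SetTheoryModels

open FirstOrder FirstOrder.Language

/-- The only non-logical symbol of the language of set theory: a binary relation symbol. -/
inductive MemRel : ℕ → Type
  | mem : MemRel 2

/-- The first-order language of set theory, `{∈}` (equality is a logical symbol). -/
def setLang : FirstOrder.Language.{0, 0} := ⟨fun _ => Empty, MemRel⟩

/-- The symbol `∈`. -/
abbrev memSymb : setLang.Relations 2 := MemRel.mem

/-- The membership relation of a structure for the language of set theory. -/
def Mem {V : Type*} [setLang.Structure V] (x y : V) : Prop :=
  Structure.RelMap memSymb ![x, y]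

/-! In a formula of type `setLang.BoundedFormula (Fin n) m`, the `n` free variables are parameters,
and the variables `&0, …, &(m-1)` are the ones bound by the quantifiers around it, numbered from
the outermost quantifier inwards. -/

/-- The atomic formula `&i ∈ &j`. -/
def memF {n m : ℕ} (i j : Fin m) : setLang.BoundedFormula (Fin n) m :=
  memSymb.boundedFormula₂ (Term.var (Sum.inr i)) (Term.var (Sum.inr j))

/-- The atomic formula `&i = &j`. -/
def eqF {n m : ℕ} (i j : Fin m) : setLang.BoundedFormula (Fin n) m :=
  Term.bdEqual (Term.var (Sum.inr i)) (Term.var (Sum.inr j))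

/-- `subst φ v` is the formula `φ(p, &(v 0), …, &(v (k-1)))`, where `φ(p, x₀, …, x_{k-1})` is a
formula with parameters `p` (the variables `Sum.inl i`) and `k` distinguished variables
(the variables `Sum.inr i`). -/
def subst {n k m : ℕ} (φ : setLang.Formula (Fin n ⊕ Fin k)) (v : Fin k → Fin m) :
    setLang.BoundedFormula (Fin n) m :=
  BoundedFormula.relabel (k := 0) (Sum.map id v) φ

/-- The universal closure of a formula over its parameters. -/
noncomputable def close {n : ℕ} (φ : setLang.Formula (Fin n)) : setLang.Sentence :=
  Formula.iAlls (α := Empty) (Fin n) (φ.relabel Sum.inr)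

/-- Empty set: `∃ e, ∀ x, x ∉ e`. -/
noncomputable def emptySetAx : setLang.Sentence :=
  close (n := 0) (∃' ∀' ∼(memF 1 0))

/-- Extensionality: `∀ a b, (∀ x, x ∈ a ↔ x ∈ b) → a = b`. -/
noncomputable def extensionalityAx : setLang.Sentence :=
  close (n := 0) (∀' ∀' ((∀' (memF 2 0 ⇔ memF 2 1)) ⟹ eqF 0 1))

/-- Pairing: `∀ a b, ∃ c, ∀ x, x ∈ c ↔ x = a ∨ x = b`. -/
noncomputable def pairingAx : setLang.Sentence :=
  close (n := 0) (∀' ∀' ∃' ∀' (memF 3 2 ⇔ (eqF 3 0 ⊔ eqF 3 1)))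

/-- Unions: `∀ a, ∃ u, ∀ x, x ∈ u ↔ ∃ y, y ∈ a ∧ x ∈ y`. -/
noncomputable def unionAx : setLang.Sentence :=
  close (n := 0) (∀' ∃' ∀' (memF 2 1 ⇔ ∃' (memF 3 0 ⊓ memF 2 3)))

/-- Infinity: `∃ w, (∃ e, e ∈ w ∧ ∀ x, x ∉ e) ∧`
`∀ x, x ∈ w → ∃ s, s ∈ w ∧ ∀ z, z ∈ s ↔ z ∈ x ∨ z = x`. -/
noncomputable def infinityAx : setLang.Sentence :=
  close (n := 0) (∃' ((∃' (memF 1 0 ⊓ ∀' ∼(memF 2 1))) ⊓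
    ∀' (memF 1 0 ⟹ ∃' (memF 2 0 ⊓ ∀' (memF 3 2 ⇔ (memF 3 1 ⊔ eqF 3 1))))))

/-- The instance of the Foundation Scheme for `φ(p, x)`:
`∀ p, (∃ x, φ(p, x)) → ∃ x, φ(p, x) ∧ ∀ y, y ∈ x → ¬ φ(p, y)`. -/
noncomputable def foundationAx {n : ℕ} (φ : setLang.Formula (Fin n ⊕ Fin 1)) : setLang.Sentence :=
  close ((∃' subst (m := 1) φ ![0]) ⟹
    ∃' (subst φ ![0] ⊓ ∀' (memF 1 0 ⟹ ∼(subst φ ![1]))))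

/-- The instance of the Separation Scheme for `φ(p, x)`:
`∀ p, ∀ a, ∃ b, ∀ x, x ∈ b ↔ x ∈ a ∧ φ(p, x)`. -/
noncomputable def separationAx {n : ℕ} (φ : setLang.Formula (Fin n ⊕ Fin 1)) : setLang.Sentence :=
  close (∀' ∃' ∀' (memF 2 1 ⇔ (memF 2 0 ⊓ subst φ ![2])))

/-- The instance of the Replacement Scheme for `φ(p, x, y)`:
`∀ p, ∀ a, (∀ x, x ∈ a → ∃ y, φ(p, x, y) ∧ ∀ z, φ(p, x, z) → z = y) →`
`∃ b, ∀ y, y ∈ b ↔ ∃ x, x ∈ a ∧ φ(p, x, y)`. -/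
noncomputable def replacementAx {n : ℕ} (φ : setLang.Formula (Fin n ⊕ Fin 2)) : setLang.Sentence :=
  close (∀' ((∀' (memF 1 0 ⟹ ∃' (subst φ ![1, 2] ⊓ ∀' (subst φ ![1, 3] ⟹ eqF 3 2)))) ⟹
    ∃' ∀' (memF 2 1 ⇔ ∃' (memF 3 0 ⊓ subst φ ![3, 2]))))

/-- The instance of the Collection Scheme for `φ(p, x, y)`:
`∀ p, ∀ a, (∀ x, x ∈ a → ∃ y, φ(p, x, y)) → ∃ b, ∀ x, x ∈ a → ∃ y, y ∈ b ∧ φ(p, x, y)`. -/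
noncomputable def collectionAx {n : ℕ} (φ : setLang.Formula (Fin n ⊕ Fin 2)) : setLang.Sentence :=
  close (∀' ((∀' (memF 1 0 ⟹ ∃' subst φ ![1, 2])) ⟹
    ∃' ∀' (memF 2 0 ⟹ ∃' (memF 3 1 ⊓ subst φ ![2, 3]))))

/-- The axioms of `ZF⁻`. -/
inductive IsZFMinusAxiom : setLang.Sentence → Prop
  | emptySet : IsZFMinusAxiom emptySetAx
  | extensionality : IsZFMinusAxiom extensionalityAx
  | pairing : IsZFMinusAxiom pairingAx
  | union : IsZFMinusAxiom unionAx
  | infinity : IsZFMinusAxiom infinityAx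
  | foundation {n : ℕ} (φ : setLang.Formula (Fin n ⊕ Fin 1)) : IsZFMinusAxiom (foundationAx φ)
  | separation {n : ℕ} (φ : setLang.Formula (Fin n ⊕ Fin 1)) : IsZFMinusAxiom (separationAx φ)
  | replacement {n : ℕ} (φ : setLang.Formula (Fin n ⊕ Fin 2)) : IsZFMinusAxiom (replacementAx φ)
  | collection {n : ℕ} (φ : setLang.Formula (Fin n ⊕ Fin 2)) : IsZFMinusAxiom (collectionAx φ)

/-- The theory `ZF⁻` (`ZF` without Power Set, with Collection). -/
def ZFMinus : setLang.Theory := {σ | IsZFMinusAxiom σ}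

/-- `j : V → V` is non-trivial: it is not the identity. -/
def IsNontrivial {V : Type*} (j : V → V) : Prop := ∃ x, j x ≠ x

/-- `j : M → N` is cofinal: every `y` in `N` is an element of some `j x`. -/
def IsCofinal {M N : Type*} [setLang.Structure N] (j : M → N) : Prop := ∀ y, ∃ x, Mem y (j x)

/-- `j : V → V` is definable from parameters: for some formula `φ` and some parameters from `V`,
`j x = y` holds if and only if `φ(x, y)` holds in `V` with these parameters. -/
def IsDefinableFromParameters {V : Type*} [setLang.Structure V] (j : V → V) : Prop :=
  (Set.univ : Set V).Definable₂ setLang {q : V × V | j q.1 = q.2}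

end SetTheoryModels

/-! Suppose `j` is defined by `φ(x, y, p)`, and let the parameter vary. If "`φ(·, ·, q)` defines a
cofinal elementary map" were expressible in `q`, the class `F` of sets fixed by all such maps would
be definable without parameters. Nontriviality of `j` puts some set outside `F`, and Foundation
gives an ∈-minimal such `x`, moved by some map `k` of the family. All elements of `x` lie in `F`. By
elementarity all elements of `k x` lie in `F` too, so `k` fixes every element of `x` and of `k x`.
Hence `z ∈ x ↔ z ∈ k x` for all `z`, and `k x = x`, a contradiction. No critical point, ordinal or
rank is needed.

Full elementarity is not one formula, so it is replaced by `IsBasicEmbedding`: a total, cofinal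
function preserving ten relations. This is first-order in `q` (`defPred_isBasicEmbedding`) and holds
of `j`. Conversely, in the style of Gaifman, cofinality and Collection yield by induction on
formulas that such maps commute with separation by any parameter-free formula (`isStable_realize`,
whose main case is `IsStable.exists_pair`). This gives `IsBasicEmbedding.forall_mem_image`, the only
part of elementarity used for `k` beyond the basic relations. -/

namespace SetTheoryModels

open FirstOrder FirstOrder.Language Set

/-! ### Closure properties of definable predicates -/

section Definability

variable {V : Type*} [setLang.Structure V] {A : Set V} {α β : Type*}

/-- The predicate `P` on tuples of elements of `V` is definable with parameters from `A`. -/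
def DefPred (A : Set V) (P : (α → V) → Prop) : Prop := A.Definable setLang {v | P v}

theorem DefPred.mono_univ {P : (α → V) → Prop} (h : DefPred ∅ P) : DefPred A P :=
  Set.Definable.mono h (empty_subset A)

theorem DefPred.congr {P Q : (α → V) → Prop} (h : DefPred A Q) (e : ∀ v, P v ↔ Q v) :
    DefPred A P := by
  have : P = Q := funext fun v => propext (e v)
  exact this ▸ h

theorem DefPred.and {P Q : (α → V) → Prop} (hP : DefPred A P) (hQ : DefPred A Q) :
    DefPred A (fun v => P v ∧ Q v) := Set.Definable.inter hP hQ

theorem DefPred.or {P Q : (α → V) → Prop} (hP : DefPred A P) (hQ : DefPred A Q) :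
    DefPred A (fun v => P v ∨ Q v) := Set.Definable.union hP hQ

theorem DefPred.not {P : (α → V) → Prop} (hP : DefPred A P) : DefPred A (fun v => ¬ P v) :=
  Set.Definable.compl hP

theorem DefPred.imp {P Q : (α → V) → Prop} (hP : DefPred A P) (hQ : DefPred A Q) :
    DefPred A (fun v => P v → Q v) :=
  (hP.not.or hQ).congr fun _ => imp_iff_not_or

theorem DefPred.iff {P Q : (α → V) → Prop} (hP : DefPred A P) (hQ : DefPred A Q) :
    DefPred A (fun v => P v ↔ Q v) :=
  ((hP.imp hQ).and (hQ.imp hP)).congr fun _ => iff_def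

theorem DefPred.subst [Finite β] {P : (β → V) → Prop} (hP : DefPred A P)
    {F : (α → V) → β → V} (hF : ∀ i, A.DefinableFun setLang (fun v => F v i)) :
    DefPred A (fun v => P (F v)) :=
  Set.Definable.preimage_map hF hP

theorem DefPred.relabel {P : (β → V) → Prop} (hP : DefPred A P) (f : β → α) :
    DefPred A (fun v => P (fun i => v (f i))) :=
  Set.Definable.preimage_comp f hP

theorem DefPred.exists_tuple [Finite β] {Q : (α → V) → (β → V) → Prop}
    (h : DefPred A (fun w : α ⊕ β → V => Q (fun a => w (.inl a)) (fun b => w (.inr b)))) :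
    DefPred A (fun v => ∃ u, Q v u) :=
  Set.Definable.exists_of_finite h

theorem DefPred.forall_tuple [Finite β] {Q : (α → V) → (β → V) → Prop}
    (h : DefPred A (fun w : α ⊕ β → V => Q (fun a => w (.inl a)) (fun b => w (.inr b)))) :
    DefPred A (fun v => ∀ u, Q v u) :=
  Set.Definable.forall_of_finite h

theorem DefPred.exists {Q : (α → V) → V → Prop}
    (h : DefPred A (fun w : α ⊕ Unit → V => Q (fun a => w (.inl a)) (w (.inr ())))) :
    DefPred A (fun v => ∃ y, Q v y) :=
  (DefPred.exists_tuple (Q := fun v u => Q v (u ())) h).congr fun _ =>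
    ⟨fun ⟨y, hy⟩ => ⟨fun _ => y, hy⟩, fun ⟨u, hu⟩ => ⟨u (), hu⟩⟩

theorem DefPred.forall {Q : (α → V) → V → Prop}
    (h : DefPred A (fun w : α ⊕ Unit → V => Q (fun a => w (.inl a)) (w (.inr ())))) :
    DefPred A (fun v => ∀ y, Q v y) :=
  (DefPred.forall_tuple (Q := fun v u => Q v (u ())) h).congr fun _ =>
    ⟨fun H _ => H _, fun H y => H fun _ => y⟩

theorem DefPred.eq {f g : (α → V) → V} (hf : A.DefinableFun setLang f)
    (hg : A.DefinableFun setLang g) : DefPred A (fun v => f v = g v) :=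
  hf.ofPred_eq hg

theorem DefPred.mem {f g : (α → V) → V} (hf : A.DefinableFun setLang f)
    (hg : A.DefinableFun setLang g) : DefPred A (fun v => Mem (f v) (g v)) := by
  have h : DefPred (∅ : Set V) (fun v : Fin 2 → V => Mem (v 0) (v 1)) := by
    refine Set.empty_definable_iff.2 ⟨memSymb.formula₂ (.var 0) (.var 1), ?_⟩
    ext v
    exact (Formula.realize_rel₂ (R := memSymb) (t₁ := Term.var 0) (t₂ := Term.var 1) (v := v)).symm
  exact (h.mono_univ (A := A)).subst (F := fun v => ![f v, g v])
    (Fin.forall_fin_two.2 ⟨hf, hg⟩)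

theorem definableFun_of_graph {f : (α → V) → V}
    (h : DefPred A (fun w : α ⊕ Unit → V => w (.inr ()) = f (fun a => w (.inl a)))) :
    A.DefinableFun setLang f := by
  have := DefPred.relabel h (α := Option α) (Sum.elim some fun _ => none)
  exact this.congr fun w => eq_comm

theorem DefPred.map_iff {P : (α → V) → Prop} (h : DefPred ∅ P) (j : V ↪ₑ[setLang] V)
    (v : α → V) : P (fun i => j (v i)) ↔ P v := by
  obtain ⟨φ, hφ⟩ := Set.empty_definable_iff.1 h
  have e : ∀ v, P v ↔ φ.Realize v := fun v => Set.ext_iff.1 hφ v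
  rw [e, e]
  exact j.map_formula φ v

/-- A formula mentions only finitely many parameters, so they can be indexed by some `Fin n`, the
form required by the axiom schemes. -/
theorem DefPred.exists_formula {k : ℕ} {P : (Fin k → V) → Prop} (h : DefPred univ P) :
    ∃ (n : ℕ) (φ : setLang.Formula (Fin n ⊕ Fin k)) (p : Fin n → V),
      ∀ v, φ.Realize (Sum.elim p v) ↔ P v := by
  obtain ⟨A₀, -, h⟩ := Set.definable_iff_finitely_definable.1 h
  obtain ⟨φ, hφ⟩ := Set.definable_iff_exists_formula_sum.1 h
  let e := A₀.equivFin
  refine ⟨_, φ.relabel (Sum.map e id), fun i => (e.symm i : V), fun v => ?_⟩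
  rw [Formula.realize_relabel]
  have h2 : Sum.elim (fun i => (e.symm i : V)) v ∘ Sum.map e id = Sum.elim (fun a : A₀ => (a : V)) v := by
    ext i
    rcases i with i | i
    · exact congrArg Subtype.val (e.symm_apply_apply i)
    · rfl
  rw [h2]
  exact (Set.ext_iff.1 hφ v).symm

end Definability

/-! ### The axioms in semantic form -/

section Axioms

variable {V : Type*} [setLang.Structure V]

theorem realize_close {n : ℕ} {φ : setLang.Formula (Fin n)} :
    V ⊨ close φ ↔ ∀ p : Fin n → V, φ.Realize p := by
  simp only [close, Sentence.Realize, Formula.realize_iAlls, Formula.realize_relabel]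
  rfl

theorem realize_memF {n m : ℕ} {i j : Fin m} {p : Fin n → V} {v : Fin m → V} :
    (memF (n := n) i j).Realize p v ↔ Mem (v i) (v j) := by
  simp [memF, Mem, BoundedFormula.realize_rel₂]

theorem realize_eqF {n m : ℕ} {i j : Fin m} {p : Fin n → V} {v : Fin m → V} :
    (eqF (n := n) i j).Realize p v ↔ v i = v j := by
  simp [eqF]

theorem realize_substF {n k m : ℕ} {φ : setLang.Formula (Fin n ⊕ Fin k)} {f : Fin k → Fin m}
    {p : Fin n → V} {v : Fin m → V} :
    (subst φ f).Realize p v ↔ φ.Realize (Sum.elim p (fun i => v (f i))) := by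
  rw [subst, BoundedFormula.realize_relabel, Formula.Realize]
  refine Eq.to_iff (congrArg₂ _ ?_ (Subsingleton.elim _ _))
  ext i
  rcases i with i | i <;> rfl

theorem ext_of_mem_iff (hV : V ⊨ ZFMinus) {a b : V} (h : ∀ x, Mem x a ↔ Mem x b) : a = b := by
  have := realize_close.1 (hV.realize_of_mem _ IsZFMinusAxiom.extensionality) default
  simp only [Formula.Realize, BoundedFormula.realize_all, BoundedFormula.realize_imp,
    BoundedFormula.realize_iff, realize_memF, realize_eqF] at this
  exact this a b h

theorem exists_unordered_pair (hV : V ⊨ ZFMinus) (a b : V) :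
    ∃ c : V, ∀ x, Mem x c ↔ x = a ∨ x = b := by
  have := realize_close.1 (hV.realize_of_mem _ IsZFMinusAxiom.pairing) default
  simp only [Formula.Realize, BoundedFormula.realize_all, BoundedFormula.realize_ex,
    BoundedFormula.realize_sup, BoundedFormula.realize_iff, realize_memF, realize_eqF] at this
  exact this a b

theorem exists_sUnion (hV : V ⊨ ZFMinus) (a : V) :
    ∃ u : V, ∀ x, Mem x u ↔ ∃ y, Mem y a ∧ Mem x y := by
  have := realize_close.1 (hV.realize_of_mem _ IsZFMinusAxiom.union) default
  simp only [Formula.Realize, BoundedFormula.realize_all, BoundedFormula.realize_ex,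
    BoundedFormula.realize_inf, BoundedFormula.realize_iff, realize_memF] at this
  exact this a

theorem exists_minimal (hV : V ⊨ ZFMinus) {P : V → Prop}
    (hP : DefPred univ (fun v : Fin 1 → V => P (v 0))) (h : ∃ x, P x) :
    ∃ x, P x ∧ ∀ y, Mem y x → ¬ P y := by
  obtain ⟨n, φ, p, hφ⟩ := hP.exists_formula
  have := realize_close.1 (hV.realize_of_mem _ (IsZFMinusAxiom.foundation φ)) p
  rw [Formula.Realize] at this
  simp only [BoundedFormula.realize_all, BoundedFormula.realize_ex,
    BoundedFormula.realize_inf, BoundedFormula.realize_imp, BoundedFormula.realize_not,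
    realize_memF, realize_substF, hφ] at this
  exact this h

theorem exists_sep (hV : V ⊨ ZFMinus) {P : V → Prop}
    (hP : DefPred univ (fun v : Fin 1 → V => P (v 0))) (a : V) :
    ∃ b, ∀ x, Mem x b ↔ Mem x a ∧ P x := by
  obtain ⟨n, φ, p, hφ⟩ := hP.exists_formula
  have := realize_close.1 (hV.realize_of_mem _ (IsZFMinusAxiom.separation φ)) p
  rw [Formula.Realize] at this
  simp only [BoundedFormula.realize_all, BoundedFormula.realize_ex,
    BoundedFormula.realize_inf, BoundedFormula.realize_iff,
    realize_memF, realize_substF, hφ] at this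
  exact this a

theorem exists_collection (hV : V ⊨ ZFMinus) {P : V → V → Prop}
    (hP : DefPred univ (fun v : Fin 2 → V => P (v 0) (v 1))) (a : V)
    (h : ∀ x, Mem x a → ∃ y, P x y) :
    ∃ b, ∀ x, Mem x a → ∃ y, Mem y b ∧ P x y := by
  obtain ⟨n, φ, p, hφ⟩ := hP.exists_formula
  have := realize_close.1 (hV.realize_of_mem _ (IsZFMinusAxiom.collection φ)) p
  rw [Formula.Realize] at this
  simp only [BoundedFormula.realize_all, BoundedFormula.realize_ex,
    BoundedFormula.realize_inf, BoundedFormula.realize_imp,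
    realize_memF, realize_substF, hφ] at this
  exact this a h

end Axioms

/-! ### Pairs, coded tuples, products and images -/

section Pairs

variable {V : Type*} [setLang.Structure V] {A : Set V} {α : Type}

/-- The unordered pair `{a, b}`. -/
noncomputable def upair (a b : V) : V :=
  @Classical.epsilon V ⟨a⟩ (fun c => ∀ x, Mem x c ↔ x = a ∨ x = b)

theorem mem_upair (hV : V ⊨ ZFMinus) {a b x : V} : Mem x (upair a b) ↔ x = a ∨ x = b :=
  @Classical.epsilon_spec V (fun c => ∀ x, Mem x c ↔ x = a ∨ x = b)
    (exists_unordered_pair hV a b) x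

/-- The Kuratowski pair `(a, b)`. -/
noncomputable def pair (a b : V) : V := upair (upair a a) (upair a b)

theorem upair_self_eq (hV : V ⊨ ZFMinus) {a b c : V} (h : upair a a = upair b c) :
    a = b ∧ a = c := by
  have hb : Mem b (upair a a) := by rw [h, mem_upair hV]; exact .inl rfl
  have hc : Mem c (upair a a) := by rw [h, mem_upair hV]; exact .inr rfl
  rw [mem_upair hV, or_self] at hb hc
  exact ⟨hb.symm, hc.symm⟩

theorem upair_right_cancel (hV : V ⊨ ZFMinus) {a b c : V} (h : upair a b = upair a c) :
    b = c := by
  have hb : Mem b (upair a c) := by rw [← h, mem_upair hV]; exact .inr rfl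
  have hc : Mem c (upair a b) := by rw [h, mem_upair hV]; exact .inr rfl
  rw [mem_upair hV] at hb hc
  grind

theorem pair_inj (hV : V ⊨ ZFMinus) {a b c d : V} (h : pair a b = pair c d) :
    a = c ∧ b = d := by
  have hac : a = c := by
    have : Mem (upair a a) (pair c d) := by rw [← h, pair, mem_upair hV]; exact .inl rfl
    rw [pair, mem_upair hV] at this
    rcases this with h | h <;> exact (upair_self_eq hV h).1
  subst hac
  exact ⟨rfl, upair_right_cancel hV (upair_right_cancel hV h)⟩

open Classical in
/-- The first coordinate of a pair. -/
noncomputable def fst (w : V) : V := if h : ∃ a b, w = pair a b then h.choose else w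

open Classical in
/-- The second coordinate of a pair. -/
noncomputable def snd (w : V) : V := if h : ∃ b a, w = pair a b then h.choose else w

theorem fst_pair (hV : V ⊨ ZFMinus) (a b : V) : fst (pair a b) = a := by
  have h : ∃ c d, pair a b = pair c d := ⟨a, b, rfl⟩
  rw [fst, dif_pos h]
  obtain ⟨d, hd⟩ := h.choose_spec
  exact (pair_inj hV hd).1.symm

theorem snd_pair (hV : V ⊨ ZFMinus) (a b : V) : snd (pair a b) = b := by
  have h : ∃ d c, pair a b = pair c d := ⟨b, a, rfl⟩
  rw [snd, dif_pos h]
  obtain ⟨d, hd⟩ := h.choose_spec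
  exact (pair_inj hV hd).2.symm

/-- The second disjunct covers the default value on non-pairs; the right-hand side shows that the
total function `fst` is definable without parameters. -/
theorem eq_fst_iff (hV : V ⊨ ZFMinus) {w x : V} :
    x = fst w ↔ (∃ y, w = pair x y) ∨ ((¬ ∃ a b, w = pair a b) ∧ x = w) := by
  by_cases h : ∃ a b, w = pair a b
  · obtain ⟨a, b, rfl⟩ := h
    rw [fst_pair hV]
    constructor
    · rintro rfl
      exact .inl ⟨b, rfl⟩
    · rintro (⟨y, hy⟩ | ⟨h, -⟩)
      · exact (pair_inj hV hy).1.symm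
      · exact absurd ⟨a, b, rfl⟩ h
  · rw [fst, dif_neg h]
    refine ⟨fun e => .inr ⟨h, e⟩, ?_⟩
    rintro (⟨y, hy⟩ | ⟨-, e⟩)
    exacts [absurd ⟨x, y, hy⟩ h, e]

theorem eq_snd_iff (hV : V ⊨ ZFMinus) {w x : V} :
    x = snd w ↔ (∃ y, w = pair y x) ∨ ((¬ ∃ b a, w = pair a b) ∧ x = w) := by
  by_cases h : ∃ b a, w = pair a b
  · obtain ⟨b, a, rfl⟩ := h
    rw [snd_pair hV]
    constructor
    · rintro rfl
      exact .inl ⟨a, rfl⟩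
    · rintro (⟨y, hy⟩ | ⟨h, -⟩)
      · exact (pair_inj hV hy).2.symm
      · exact absurd ⟨b, a, rfl⟩ h
  · rw [snd, dif_neg h]
    refine ⟨fun e => .inr ⟨h, e⟩, ?_⟩
    rintro (⟨y, hy⟩ | ⟨-, e⟩)
    exacts [absurd ⟨x, y, hy⟩ h, e]

theorem definableFun_comp₁ {F : V → V}
    (hF : DefPred (∅ : Set V) (fun v : Fin 2 → V => v 1 = F (v 0)))
    {f : (α → V) → V} (hf : A.DefinableFun setLang f) :
    A.DefinableFun setLang (fun v => F (f v)) := by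
  have h : (∅ : Set V).DefinableFun setLang (fun v : Fin 1 → V => F (v 0)) :=
    definableFun_of_graph (hF.relabel (α := Fin 1 ⊕ Unit) ![Sum.inl 0, Sum.inr ()])
  exact (Set.DefinableFun.of_empty h).comp (g := fun v _ => f v) fun _ => hf

theorem definableFun_upair (hV : V ⊨ ZFMinus) {f g : (α → V) → V}
    (hf : A.DefinableFun setLang f) (hg : A.DefinableFun setLang g) :
    A.DefinableFun setLang (fun v => upair (f v) (g v)) := by
  have h : (∅ : Set V).DefinableFun setLang (fun v : Fin 2 → V => upair (v 0) (v 1)) := by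
    refine definableFun_of_graph (DefPred.congr (Q := fun w : Fin 2 ⊕ Unit → V =>
      ∀ x, Mem x (w (.inr ())) ↔ x = w (.inl 0) ∨ x = w (.inl 1)) ?_ fun w => ?_)
    · exact .forall (.iff (.mem (.proj _) (.proj _)) (.or (.eq (.proj _) (.proj _)) (.eq (.proj _) (.proj _))))
    · exact ⟨fun e x => e ▸ mem_upair hV,
        fun h => ext_of_mem_iff hV fun x => (h x).trans (mem_upair hV).symm⟩
  exact (Set.DefinableFun.of_empty h).comp (g := fun v => ![f v, g v])
    (Fin.forall_fin_two.2 ⟨hf, hg⟩)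

theorem definableFun_pair (hV : V ⊨ ZFMinus) {f g : (α → V) → V}
    (hf : A.DefinableFun setLang f) (hg : A.DefinableFun setLang g) :
    A.DefinableFun setLang (fun v => pair (f v) (g v)) :=
  definableFun_upair hV (definableFun_upair hV hf hf) (definableFun_upair hV hf hg)

theorem definableFun_fst (hV : V ⊨ ZFMinus) {f : (α → V) → V}
    (hf : A.DefinableFun setLang f) : A.DefinableFun setLang (fun v => fst (f v)) := by
  refine definableFun_comp₁ (DefPred.congr ?_ fun v => eq_fst_iff hV) hf
  exact .or (.exists (.eq (.proj _) (definableFun_pair hV (.proj _) (.proj _))))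
    (.and (.not (.exists (.exists (.eq (.proj _) (definableFun_pair hV (.proj _) (.proj _))))))
      (.eq (.proj _) (.proj _)))

theorem definableFun_snd (hV : V ⊨ ZFMinus) {f : (α → V) → V}
    (hf : A.DefinableFun setLang f) : A.DefinableFun setLang (fun v => snd (f v)) := by
  refine definableFun_comp₁ (DefPred.congr ?_ fun v => eq_snd_iff hV) hf
  exact .or (.exists (.eq (.proj _) (definableFun_pair hV (.proj _) (.proj _))))
    (.and (.not (.exists (.exists (.eq (.proj _) (definableFun_pair hV (.proj _) (.proj _))))))
      (.eq (.proj _) (.proj _)))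

/-- The map sending `((a, b), c)` to `(a, c)`. -/
noncomputable def dropMid (w : V) : V := pair (fst (fst w)) (snd w)

theorem definableFun_dropMid (hV : V ⊨ ZFMinus) {f : (α → V) → V}
    (hf : A.DefinableFun setLang f) : A.DefinableFun setLang (fun v => dropMid (f v)) :=
  definableFun_pair hV (definableFun_fst hV (definableFun_fst hV hf)) (definableFun_snd hV hf)

theorem definableFun_const_univ (a : V) :
    (univ : Set V).DefinableFun setLang (fun _ : α → V => a) :=
  definableFun_const _ _ (mem_univ a)

/-- The tuple of length `n` coded by `t`, where `(s, x)` codes the tuple coded by `s` followed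
by `x`. -/
noncomputable def tupleOf : (n : ℕ) → V → Fin n → V
  | 0, _ => Fin.elim0
  | n + 1, t => Fin.snoc (α := fun _ => V) (tupleOf n (fst t)) (snd t)

theorem tupleOf_pair (hV : V ⊨ ZFMinus) (n : ℕ) (s x : V) :
    tupleOf (n + 1) (pair s x) = Fin.snoc (α := fun _ => V) (tupleOf n s) x := by
  rw [tupleOf, fst_pair hV, snd_pair hV]

theorem exists_union (hV : V ⊨ ZFMinus) (a b : V) : ∃ u, ∀ x, Mem x u ↔ Mem x a ∨ Mem x b := by
  obtain ⟨u, hu⟩ := exists_sUnion hV (upair a b)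
  refine ⟨u, fun x => (hu x).trans ?_⟩
  simp [mem_upair hV]

/-- Without Power Set, Collection replaces the usual bound: once over `b` to bound each row `{x} ×
b`, and once over `a` to bound all rows together. Union and Separation finish. -/
theorem exists_prod (hV : V ⊨ ZFMinus) (a b : V) :
    ∃ c, ∀ w, Mem w c ↔ ∃ x y, Mem x a ∧ Mem y b ∧ w = pair x y := by
  have row : ∀ x, ∃ s, ∀ y, Mem y b → Mem (pair x y) s := by
    intro x
    obtain ⟨s, hs⟩ := exists_collection hV (P := fun y w => w = pair x y)
      (.eq (.proj _) (definableFun_pair hV (definableFun_const_univ x) (.proj _))) b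
      fun y _ => ⟨_, rfl⟩
    refine ⟨s, fun y hy => ?_⟩
    obtain ⟨w, hw, rfl⟩ := hs y hy
    exact hw
  obtain ⟨D, hD⟩ := exists_collection hV (P := fun x s => ∀ y, Mem y b → Mem (pair x y) s)
    (.forall (.imp (.mem (.proj _) (definableFun_const_univ b))
      (.mem (definableFun_pair hV (.proj _) (.proj _)) (.proj _)))) a fun x _ => row x
  obtain ⟨u, hu⟩ := exists_sUnion hV D
  obtain ⟨c, hc⟩ := exists_sep hV (P := fun w => ∃ x y, Mem x a ∧ Mem y b ∧ w = pair x y)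
    (.exists (.exists (.and (.mem (.proj _) (definableFun_const_univ a))
      (.and (.mem (.proj _) (definableFun_const_univ b))
        (.eq (.proj _) (definableFun_pair hV (.proj _) (.proj _))))))) u
  refine ⟨c, fun w => (hc w).trans ⟨And.right, fun h => ⟨?_, h⟩⟩⟩
  obtain ⟨x, y, hx, hy, rfl⟩ := h
  obtain ⟨s, hs, h⟩ := hD x hx
  exact (hu _).2 ⟨s, hs, h y hy⟩

theorem exists_image (hV : V ⊨ ZFMinus) {F : V → V}
    (hF : DefPred univ (fun v : Fin 2 → V => v 1 = F (v 0))) (a : V) :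
    ∃ b, ∀ y, Mem y b ↔ ∃ x, Mem x a ∧ y = F x := by
  obtain ⟨u, hu⟩ := exists_collection hV (P := fun x y => y = F x) hF a fun x _ => ⟨_, rfl⟩
  obtain ⟨b, hb⟩ := exists_sep hV (P := fun y => ∃ x, Mem x a ∧ y = F x)
    (.exists (.and (.mem (.proj _) (definableFun_const_univ a))
      (hF.relabel (α := Fin 1 ⊕ Unit) ![Sum.inr (), Sum.inl 0]))) u
  refine ⟨b, fun y => (hb y).trans ⟨And.right, fun h => ⟨?_, h⟩⟩⟩
  obtain ⟨x, hx, rfl⟩ := h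
  obtain ⟨y, hy, rfl⟩ := hu x hx
  exact hy

end Pairs

/-! ### Cofinal maps preserving the basic relations -/

section CofinalMaps

variable {V : Type*} [setLang.Structure V] {A : Set V} {α : Type}

/-- Names for finitely many `Δ₀` relations whose preservation by a cofinal map implies that the
map is elementary. -/
inductive BasicRel
  | mem | notMem | subset | diff | prod | dom | image | preimage | sepEq | sepMem

instance : Finite BasicRel :=
  Finite.of_surjective (α := Fin 10)
    ![.mem, .notMem, .subset, .diff, .prod, .dom, .image, .preimage, .sepEq, .sepMem]
    fun r => by
      cases r
      exacts [⟨0, rfl⟩, ⟨1, rfl⟩, ⟨2, rfl⟩, ⟨3, rfl⟩, ⟨4, rfl⟩, ⟨5, rfl⟩, ⟨6, rfl⟩, ⟨7, rfl⟩,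
        ⟨8, rfl⟩, ⟨9, rfl⟩]

/-- The relation with a given name. -/
def BasicRel.Holds : BasicRel → V → V → V → Prop
  | mem, a, b, _ => Mem a b
  | notMem, a, b, _ => ¬ Mem a b
  | subset, a, b, _ => ∀ x, Mem x a → Mem x b
  | diff, a, b, c => ∀ x, Mem x c ↔ Mem x a ∧ ¬ Mem x b
  | prod, a, b, c => ∀ w, Mem w c ↔ ∃ x y, Mem x a ∧ Mem y b ∧ w = pair x y
  | dom, a, b, _ => ∀ x, Mem x b ↔ ∃ y, Mem (pair x y) a
  | image, a, b, _ => ∀ y, Mem y b ↔ ∃ x, Mem x a ∧ y = dropMid x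
  | preimage, a, b, c => ∀ x, Mem x c ↔ Mem x a ∧ Mem (dropMid x) b
  | sepEq, a, b, _ => ∀ w, Mem w b ↔ Mem w a ∧ snd w = snd (fst w)
  | sepMem, a, b, _ => ∀ w, Mem w b ↔ Mem w a ∧ Mem (snd w) (snd (fst w))

theorem BasicRel.defPred_holds (hV : V ⊨ ZFMinus) (r : BasicRel) {f g h : (α → V) → V}
    (hf : A.DefinableFun setLang f) (hg : A.DefinableFun setLang g)
    (hh : A.DefinableFun setLang h) : DefPred A (fun v => r.Holds (f v) (g v) (h v)) := by
  have key : DefPred (∅ : Set V) (fun v : Fin 3 → V => r.Holds (v 0) (v 1) (v 2)) := by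
    cases r with
    | mem => exact .mem (.proj _) (.proj _)
    | notMem => exact .not (.mem (.proj _) (.proj _))
    | subset => exact .forall (.imp (.mem (.proj _) (.proj _)) (.mem (.proj _) (.proj _)))
    | diff => exact .forall (.iff (.mem (.proj _) (.proj _))
        (.and (.mem (.proj _) (.proj _)) (.not (.mem (.proj _) (.proj _)))))
    | prod => exact .forall (.iff (.mem (.proj _) (.proj _)) (.exists (.exists (.and (.mem (.proj _) (.proj _))
        (.and (.mem (.proj _) (.proj _)) (.eq (.proj _) (definableFun_pair hV (.proj _) (.proj _))))))))
    | dom => exact .forall (.iff (.mem (.proj _) (.proj _))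
        (.exists (.mem (definableFun_pair hV (.proj _) (.proj _)) (.proj _))))
    | image => exact .forall (.iff (.mem (.proj _) (.proj _)) (.exists (.and (.mem (.proj _) (.proj _))
        (.eq (.proj _) (definableFun_dropMid hV (.proj _))))))
    | preimage => exact .forall (.iff (.mem (.proj _) (.proj _)) (.and (.mem (.proj _) (.proj _))
        (.mem (definableFun_dropMid hV (.proj _)) (.proj _))))
    | sepEq => exact .forall (.iff (.mem (.proj _) (.proj _)) (.and (.mem (.proj _) (.proj _))
        (.eq (definableFun_snd hV (.proj _)) (definableFun_snd hV (definableFun_fst hV (.proj _))))))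
    | sepMem => exact .forall (.iff (.mem (.proj _) (.proj _)) (.and (.mem (.proj _) (.proj _))
        (.mem (definableFun_snd hV (.proj _)) (definableFun_snd hV (definableFun_fst hV (.proj _))))))
  refine (key.mono_univ (A := A)).subst (F := fun v => ![f v, g v, h v]) fun i => ?_
  fin_cases i
  exacts [hf, hg, hh]

/-- `J` is the graph of a cofinal map that preserves the basic relations. -/
def IsBasicEmbedding (J : V → V → Prop) : Prop :=
  (∀ x, ∃ y, J x y) ∧ (∀ x y z, J x y → J x z → y = z) ∧ (∀ y, ∃ x z, J x z ∧ Mem y z) ∧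
    ∀ r : BasicRel, ∀ a b c a' b' c', J a a' → J b b' → J c c' →
      r.Holds a b c → r.Holds a' b' c'

/-- Finiteness of `BasicRel` is essential: preservation is a finite conjunction of definable
conditions, hence a single formula in the parameter of `J`. -/
theorem defPred_isBasicEmbedding (hV : V ⊨ ZFMinus) {J : (α → V) → V → V → Prop}
    (hJ : DefPred A (fun w : α ⊕ Fin 2 → V => J (fun a => w (.inl a)) (w (.inr 0)) (w (.inr 1)))) :
    DefPred A (fun v => IsBasicEmbedding (J v)) := by
  have hJ' : ∀ {γ : Type} (e : α → γ) (x y : γ),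
      DefPred A (fun w : γ → V => J (fun a => w (e a)) (w x) (w y)) :=
    fun e x y => hJ.relabel (Sum.elim e ![x, y])
  refine .and (.forall (.exists (hJ' _ _ _))) (.and ?_ (.and ?_ ?_))
  · exact .forall (.forall (.forall (.imp (hJ' _ _ _) (.imp (hJ' _ _ _) (.eq (.proj _) (.proj _))))))
  · exact .forall (.exists (.exists (.and (hJ' _ _ _) (.mem (.proj _) (.proj _)))))
  · refine DefPred.congr (Q := fun v => v ∈ ⋂ r : BasicRel, {v | ∀ a b c a' b' c',
      J v a a' → J v b b' → J v c c' → r.Holds a b c → r.Holds a' b' c'})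
      (definable_iInter_of_finite fun r => ?_) fun v => by simp only [mem_iInter, mem_ofPred_eq]
    exact DefPred.forall (.forall (.forall (.forall (.forall (.forall (.imp (hJ' _ _ _)
      (.imp (hJ' _ _ _) (.imp (hJ' _ _ _) (.imp (r.defPred_holds hV (.proj _) (.proj _) (.proj _))
        (r.defPred_holds hV (.proj _) (.proj _) (.proj _)))))))))))

theorem isBasicEmbedding_of_elementary (hV : V ⊨ ZFMinus) (j : V ↪ₑ[setLang] V)
    (hj : IsCofinal j) : IsBasicEmbedding (fun x y => j x = y) := by
  refine ⟨fun x => ⟨_, rfl⟩, fun x y z hy hz => hy.symm.trans hz,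
    fun y => (hj y).imp fun x hx => ⟨_, rfl, hx⟩, ?_⟩
  rintro r a b c _ _ _ rfl rfl rfl h
  exact (DefPred.map_iff (r.defPred_holds hV (f := fun v : Fin 3 → V => v 0) (g := fun v => v 1)
    (h := fun v => v 2) (.proj _) (.proj _) (.proj _)) j ![a, b, c]).2 h

/-- The class `P` is definable with parameters, and for all sets `b` the map `j` sends
`{x ∈ b | P x}` to `{x ∈ j b | P x}`. -/
def IsStable (j : V → V) (P : V → Prop) : Prop :=
  DefPred univ (fun v : Fin 1 → V => P (v 0)) ∧
    ∀ b c, (∀ x, Mem x c ↔ Mem x b ∧ P x) → ∀ x, Mem x (j c) ↔ Mem x (j b) ∧ P x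

/-! ### Closure properties of stable classes -/

namespace IsStable

variable {j : V → V} {P Q : V → Prop}

theorem congr (hQ : IsStable j Q) (h : ∀ x, P x ↔ Q x) : IsStable j P := by
  have : P = Q := funext fun x => propext (h x)
  exact this ▸ hQ

theorem not (hV : V ⊨ ZFMinus) (hj : IsBasicEmbedding (fun x y => j x = y))
    (hP : IsStable j P) : IsStable j (fun x => ¬ P x) := by
  refine ⟨hP.1.not, fun b c hc x => ?_⟩
  obtain ⟨d, hd⟩ := exists_sep hV hP.1 b
  have h := hj.2.2.2 .diff b d c _ _ _ rfl rfl rfl (fun x => by rw [hc, hd]; tauto)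
  rw [h x, hP.2 b d hd]
  tauto

theorem and (hV : V ⊨ ZFMinus) (hP : IsStable j P) (hQ : IsStable j Q) :
    IsStable j (fun x => P x ∧ Q x) := by
  refine ⟨hP.1.and hQ.1, fun b c hc x => ?_⟩
  obtain ⟨d, hd⟩ := exists_sep hV hP.1 b
  rw [hQ.2 d c (fun x => by rw [hc, hd, and_assoc]), hP.2 b d hd, and_assoc]

theorem imp (hV : V ⊨ ZFMinus) (hj : IsBasicEmbedding (fun x y => j x = y))
    (hP : IsStable j P) (hQ : IsStable j Q) : IsStable j (fun x => P x → Q x) :=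
  (((hP.and hV (hQ.not hV hj)).not hV hj)).congr fun x => by tauto

/-- Collection bounds the witnesses by a set `d`, so the separated set is the domain of `{w ∈ b × d
| Q w}`, and `j` preserves products and domains. This only yields witnesses in `j d`; cofinality
reaches an arbitrary witness after enlarging `d`. -/
theorem exists_pair (hV : V ⊨ ZFMinus) (hj : IsBasicEmbedding (fun x y => j x = y))
    (hQ : IsStable j Q) : IsStable j (fun t => ∃ y, Q (pair t y)) := by
  have hQ' : ∀ {γ : Type} {f : (γ → V) → V}, (univ : Set V).DefinableFun setLang f →
      DefPred univ (fun v => Q (f v)) :=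
    fun {γ f} hf => hQ.1.subst (F := fun v _ => f v) fun _ => hf
  have hQp : DefPred univ (fun v : Fin 2 → V => Q (pair (v 0) (v 1))) :=
    hQ' (definableFun_pair hV (.proj _) (.proj _))
  refine ⟨.exists (hQ' (definableFun_pair hV (.proj _) (.proj _))), fun b e he => ?_⟩
  obtain ⟨b', hb'⟩ := exists_sep hV (P := fun t => ∃ y, Q (pair t y))
    (.exists (hQ' (definableFun_pair hV (.proj _) (.proj _)))) b
  obtain ⟨d, hd⟩ := exists_collection hV hQp b' fun t ht => ((hb' t).1 ht).2
  -- The set `j e` can be computed from any bound that contains `d`.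
  have key : ∀ d', (∀ y, Mem y d → Mem y d') → ∀ x,
      Mem x (j e) ↔ Mem x (j b) ∧ ∃ y, Mem y (j d') ∧ Q (pair x y) := by
    intro d' hd' x
    obtain ⟨p, hp⟩ := exists_prod hV b d'
    obtain ⟨c, hc⟩ := exists_sep hV hQ.1 p
    have mem_p : ∀ {a b p x y : V}, BasicRel.Holds .prod a b p →
        (Mem (pair x y) p ↔ Mem x a ∧ Mem y b) := by
      intro a b p x y h
      refine (h _).trans ⟨?_, fun h => ⟨x, y, h.1, h.2, rfl⟩⟩
      rintro ⟨x', y', hx, hy, e⟩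
      obtain ⟨rfl, rfl⟩ := pair_inj hV e
      exact ⟨hx, hy⟩
    have hdom : BasicRel.Holds .dom c e e := by
      intro x
      rw [he]
      simp only [hc, mem_p hp]
      constructor
      · rintro ⟨hx, hy⟩
        obtain ⟨y, hy, hQy⟩ := hd x ((hb' x).2 ⟨hx, hy⟩)
        exact ⟨y, ⟨hx, hd' y hy⟩, hQy⟩
      · rintro ⟨y, ⟨hx, -⟩, hQy⟩
        exact ⟨hx, y, hQy⟩
    rw [hj.2.2.2 .dom c e e _ _ _ rfl rfl rfl hdom x]
    simp only [hQ.2 p c hc, mem_p (hj.2.2.2 .prod b d' p _ _ _ rfl rfl rfl hp), and_assoc,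
      exists_and_left]
  intro x
  constructor
  · intro hx
    obtain ⟨hx, y, -, hQy⟩ := (key d (fun _ h => h) x).1 hx
    exact ⟨hx, y, hQy⟩
  · rintro ⟨hx, y, hQy⟩
    -- The witness `y` need not lie in `j d`, but it lies in some `j u`, hence in `j (d ∪ u)`, and
    -- `key` applies to this larger bound.
    obtain ⟨u, _, rfl, hu⟩ := hj.2.2.1 y
    obtain ⟨d', hd'⟩ := exists_union hV d u
    refine (key d' (fun y hy => (hd' y).2 (.inl hy)) x).2 ⟨hx, y, ?_, hQy⟩
    exact hj.2.2.2 .subset u d' d' _ _ _ rfl rfl rfl (fun z hz => (hd' z).2 (.inr hz)) y hu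

/-- The separated set is the preimage in `b` of the `Q`-part of the image of `b`, and `j` preserves
images and preimages under `dropMid`. -/
theorem comp_dropMid (hV : V ⊨ ZFMinus) (hj : IsBasicEmbedding (fun x y => j x = y))
    (hQ : IsStable j Q) : IsStable j (fun w => Q (dropMid w)) := by
  refine ⟨hQ.1.subst (F := fun v _ => dropMid (v 0)) fun _ => definableFun_dropMid hV (.proj _),
    fun b e he x => ?_⟩
  obtain ⟨d, hd⟩ := exists_image hV (F := dropMid) (.eq (.proj _) (definableFun_dropMid hV (.proj _))) b
  obtain ⟨c, hc⟩ := exists_sep hV hQ.1 d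
  have hpre : BasicRel.Holds .preimage b c e := by
    intro x
    rw [he, hc, hd]
    exact and_congr_right fun hx => ⟨fun h => ⟨⟨x, hx, rfl⟩, h⟩, And.right⟩
  have hd' := hj.2.2.2 .image b d d _ _ _ rfl rfl rfl hd
  rw [hj.2.2.2 .preimage b c e _ _ _ rfl rfl rfl hpre x, hQ.2 d c hc, hd']
  exact and_congr_right fun hx => ⟨And.right, fun h => ⟨⟨x, hx, rfl⟩, h⟩⟩

/-- The hypothesis handles the last entry of the tuple; `dropMid` deletes that entry, so earlier
ones follow by induction. Thus two basic relations suffice for all variable indices. -/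
theorem tupleOf (hV : V ⊨ ZFMinus) (hj : IsBasicEmbedding (fun x y => j x = y))
    {B : V → V → Prop} (hB : IsStable j (fun w => B (snd w) (snd (fst w)))) {n : ℕ} (i : Fin n) :
    IsStable j (fun w => B (snd w) (tupleOf n (fst w) i)) := by
  induction n with
  | zero => exact i.elim0
  | succ n ih =>
    induction i using Fin.lastCases with
    | last => simpa only [SetTheoryModels.tupleOf, Fin.snoc_last] using hB
    | cast i =>
      refine ((ih i).comp_dropMid hV hj).congr fun w => ?_
      simp only [SetTheoryModels.tupleOf, Fin.snoc_castSucc, dropMid, fst_pair hV, snd_pair hV]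

theorem tupleOf_eq (hV : V ⊨ ZFMinus) (hj : IsBasicEmbedding (fun x y => j x = y)) {n : ℕ}
    (i : Fin n) : IsStable j (fun w => snd w = SetTheoryModels.tupleOf n (fst w) i) :=
  tupleOf hV hj (B := fun x y => x = y)
    ⟨.eq (definableFun_snd hV (.proj _)) (definableFun_snd hV (definableFun_fst hV (.proj _))),
      fun b c h => hj.2.2.2 .sepEq b c c _ _ _ rfl rfl rfl h⟩ i

theorem tupleOf_mem (hV : V ⊨ ZFMinus) (hj : IsBasicEmbedding (fun x y => j x = y)) {n : ℕ}
    (i : Fin n) : IsStable j (fun w => Mem (snd w) (SetTheoryModels.tupleOf n (fst w) i)) :=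
  tupleOf hV hj (B := Mem)
    ⟨.mem (definableFun_snd hV (.proj _)) (definableFun_snd hV (definableFun_fst hV (.proj _))),
      fun b c h => hj.2.2.2 .sepMem b c c _ _ _ rfl rfl rfl h⟩ i

end IsStable

theorem exists_var_of_term {n : ℕ} (t : setLang.Term (Empty ⊕ Fin n)) :
    ∃ i, t = .var (.inr i) := by
  cases t with
  | var x => rcases x with x | i; exacts [x.elim, ⟨i, rfl⟩]
  | func f => exact Empty.elim f

/-- Coding the variables into one set `t` makes each formula a class, and appending an entry by
`pair` turns a quantifier into `exists_pair`. -/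
theorem isStable_realize (hV : V ⊨ ZFMinus) {j : V → V}
    (hj : IsBasicEmbedding (fun x y => j x = y)) {n : ℕ} (φ : setLang.BoundedFormula Empty n) :
    IsStable j (fun t => φ.Realize default (tupleOf n t)) := by
  induction φ with
  | falsum =>
    refine ⟨definable_empty, fun b c hc x => ?_⟩
    have h := hj.2.2.2 .diff b b c _ _ _ rfl rfl rfl
      (fun x => (hc x).trans (and_congr_right fun hx => ⟨False.elim, fun h => h hx⟩)) x
    exact h.trans (and_congr_right fun hx => ⟨fun h => h hx, False.elim⟩)
  | @equal n t₁ t₂ =>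
    obtain ⟨i, rfl⟩ := exists_var_of_term t₁
    obtain ⟨k, rfl⟩ := exists_var_of_term t₂
    -- The atom `tᵢ = tₖ` is read as `∃ y, y = tᵢ ∧ y = tₖ`, so that only comparisons of a new entry
    -- with one entry of `t` occur.
    refine (((IsStable.tupleOf_eq hV hj i).and hV
      (IsStable.tupleOf_eq hV hj k)).exists_pair hV hj).congr fun t => ?_
    simp [fst_pair hV, snd_pair hV, BoundedFormula.Realize]
  | @rel n l R ts =>
    cases R
    obtain ⟨i, hi⟩ := exists_var_of_term (ts 0)
    obtain ⟨k, hk⟩ := exists_var_of_term (ts 1)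
    refine (((IsStable.tupleOf_eq hV hj i).and hV
      (IsStable.tupleOf_mem hV hj k)).exists_pair hV hj).congr fun t => ?_
    have : (fun i => (ts i).realize (Sum.elim default (tupleOf n t))) =
        ![tupleOf n t i, tupleOf n t k] := by
      ext m
      fin_cases m
      · simp [hi]
      · simp [hk]
    simp only [BoundedFormula.Realize, this, fst_pair hV, snd_pair hV]
    simp [Mem]
  | imp _ _ ih₁ ih₂ => exact ih₁.imp hV hj ih₂
  | all _ ih =>
    refine (((ih.not hV hj).exists_pair hV hj).not hV hj).congr fun t => ?_
    simp [tupleOf_pair hV]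

/-- Definable classes that include a set also include its image under a cofinal map preserving
the basic relations. -/
theorem IsBasicEmbedding.forall_mem_image (hV : V ⊨ ZFMinus) {j : V → V}
    (hj : IsBasicEmbedding (fun x y => j x = y)) {F : V → Prop}
    (hF : DefPred ∅ (fun v : Fin 1 → V => F (v 0))) {x : V} (hx : ∀ y, Mem y x → F y) {z : V}
    (hz : Mem z (j x)) : F z := by
  obtain ⟨φ, hφ⟩ := Set.empty_definable_iff.1 hF
  have hφ' : ∀ s y : V, (BoundedFormula.relabel (β := Empty) Sum.inr φ).Realize default
      (tupleOf 1 (pair s y)) ↔ F y := by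
    intro s y
    refine (Formula.realize_relabel_sumInr φ).trans ((Set.ext_iff.1 hφ _).symm.trans ?_)
    rw [tupleOf_pair hV]
    rfl
  have hst := isStable_realize hV hj (BoundedFormula.relabel (β := Empty) (n := 1) Sum.inr φ)
  -- A code of a 1-tuple is a pair with arbitrary first coordinate, so `x × x` consists of codes of
  -- elements of `x`. Separation by `φ` leaves it unchanged, hence leaves `j x × j x` unchanged.
  obtain ⟨b, hb⟩ := exists_prod hV x x
  have h := (hst.2 b b (fun w => ⟨fun hw => ⟨hw, ?_⟩, And.left⟩) (pair z z)).1
    ((hj.2.2.2 .prod x x b _ _ _ rfl rfl rfl hb _).2 ⟨z, z, hz, hz, rfl⟩)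
  · exact (hφ' z z).1 h.2
  · obtain ⟨s, y, -, hy, rfl⟩ := (hb w).1 hw
    exact (hφ' s y).2 (hx y hy)

end CofinalMaps

end SetTheoryModels

/-! ### The contradiction from a minimal moved set -/

open SetTheoryModels

theorem mainTheorem9 (V : Type*) [SetTheoryModels.setLang.Structure V]
    (hV : V ⊨ SetTheoryModels.ZFMinus) :
    ¬ ∃ j : V ↪ₑ[SetTheoryModels.setLang] V,
      SetTheoryModels.IsNontrivial j ∧ SetTheoryModels.IsCofinal j ∧
        SetTheoryModels.IsDefinableFromParameters j := by
  rintro ⟨j, ⟨x₀, hx₀⟩, hcof, hdef⟩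
  obtain ⟨n, φ, p, hφ⟩ := DefPred.exists_formula
    (P := fun v : Fin 2 → V => j (v 0) = v 1) hdef
  let J : (Fin n → V) → V → V → Prop := fun q x y => φ.Realize (Sum.elim q ![x, y])
  have hJp : J p = fun x y => j x = y := funext fun x => funext fun y => propext (hφ ![x, y])
  have hJ : DefPred ∅ (fun w : Fin n ⊕ Fin 2 → V =>
      J (fun a => w (.inl a)) (w (.inr 0)) (w (.inr 1))) := by
    refine Set.empty_definable_iff.2 ⟨φ, Set.ext fun w => Eq.to_iff (congrArg φ.Realize ?_)⟩
    ext i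
    rcases i with i | i
    · rfl
    · fin_cases i <;> rfl
  -- Quantifying over all `q` removes the parameter `p`; stability is available only for
  -- parameter-free classes.
  have hF : DefPred ∅ (fun v : Fin 1 → V => ∀ q, IsBasicEmbedding (J q) → J q (v 0) (v 0)) := by
    refine DefPred.forall_tuple (.imp ?_ ?_)
    · exact (defPred_isBasicEmbedding hV hJ).relabel Sum.inr
    · exact hJ.relabel (Sum.elim Sum.inr fun _ => Sum.inl 0)
  have hx₀' : ∃ x, ¬ ∀ q, IsBasicEmbedding (J q) → J q x x := by
    refine ⟨x₀, fun h => hx₀ ?_⟩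
    have := h p (hJp ▸ isBasicEmbedding_of_elementary hV j hcof)
    rwa [hJp] at this
  obtain ⟨x, hx, hmin⟩ := exists_minimal hV (hF.not.mono_univ) hx₀'
  push Not at hx hmin
  obtain ⟨q, hq, hxq⟩ := hx
  choose k hk using hq.1
  have hJk : J q = fun x y => k x = y := funext fun x => funext fun y => propext
    ⟨fun h => hq.2.1 _ _ _ (hk x) h, fun h => h ▸ hk x⟩
  have hk' := hJk ▸ hq
  have fixed : ∀ z, (∀ q, IsBasicEmbedding (J q) → J q z z) → k z = z := by
    intro z hz
    have := hz q hq
    rwa [hJk] at this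
  refine hxq ?_
  rw [hJk]
  refine ext_of_mem_iff hV fun z => ⟨fun hz => ?_, fun hz => ?_⟩
  · by_contra hzx
    refine hk'.2.2.2 .notMem z x x _ _ _ rfl rfl rfl hzx ?_
    -- Here `z` is only known to lie in `k x`; it is fixed by `k` because the inclusion of `x` in
    -- the class `F` transfers to `k x`.
    rwa [fixed z (hk'.forall_mem_image hV hF hmin hz)]
  · have := hk'.2.2.2 .mem z x x _ _ _ rfl rfl rfl hz
    rwa [fixed z (hmin z hz)] at this
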